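/- Let $g,h\ge 2$ be integers. Let $\Sigma_g$ and $\Sigma_h$ be closed, connected, orientable smooth surfaces of genus $g$ and $h$, each equipped with a hyperbolic metric, i.e. a smooth Riemannian metric of constant sectional curvature $-1$. Then the product metric $\gamma=\pi_1^*\gamma_{\Sigma_g}+\pi_2^*\gamma_{\Sigma_h}$ on the 4-manifold $\Sigma_g\times\Sigma_h$ is neither locally conformally flat nor self-dual. That is: 1. It is not true that every point has an open neighbourhood $U$ with a smooth function $f:U\to(0,\infty)$ such that $f\gamma$ has zero sectional curvature everywhere on $U$. 2. For either orientation of $\Sigma_g\times\Sigma_h$, the part $W_-:\Lambda^2_-\to\Lambda^2_-$ of the Weyl tensor of $\gamma$, viewed as an operator on 2-forms, does not vanish identically. Here $\Lambda^2_-$ is the $(-1)$-eigenspace of the Hodge star on 2-forms. -/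

import Mathlib

set_option maxSynthPendingDepth 3

open Set Bundle Manifold Topology
open scoped ContDiff

noncomputable section

namespace HyperbolicProduct

/-! ### Curvature of a metric on an open subset of a vector space -/

section Coordinates

variable {E : Type*} [NormedAddCommGroup E] [NormedSpace ℝ E]

/-- Christoffel symbols of the first kind:
`Γ(u, v; w) = (∂_u G(v, w) + ∂_v G(u, w) - ∂_w G(u, v)) / 2`. -/
def christoffelFirst (G : E → E →L[ℝ] E →L[ℝ] ℝ) (y : E) : E →L[ℝ] E →L[ℝ] E →L[ℝ] ℝ :=
  let D : E →L[ℝ] E →L[ℝ] E →L[ℝ] ℝ := fderiv ℝ G y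
  (1 / 2 : ℝ) • (D + D.flip -
    ((ContinuousLinearMap.flipₗᵢ ℝ E E ℝ).toContinuousLinearEquiv :
      (E →L[ℝ] E →L[ℝ] ℝ) →L[ℝ] (E →L[ℝ] E →L[ℝ] ℝ)).comp D.flip)

theorem christoffelFirst_apply (G : E → E →L[ℝ] E →L[ℝ] ℝ) (y u v w : E) :
    christoffelFirst G y u v w =
      (1 / 2) * (fderiv ℝ G y u v w + fderiv ℝ G y v u w - fderiv ℝ G y w u v) := rfl

/-- Christoffel symbols of the second kind, i.e. the Levi-Civita connection in coordinates:
`G(Γ(u, v), w) = Γ(u, v; w)`, obtained by raising an index. -/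
def christoffel (G : E → E →L[ℝ] E →L[ℝ] ℝ) (y : E) : E →L[ℝ] E →L[ℝ] E :=
  (ContinuousLinearMap.compL ℝ E (E →L[ℝ] ℝ) E (G y).inverse).comp (christoffelFirst G y)

theorem christoffel_apply (G : E → E →L[ℝ] E →L[ℝ] ℝ) (y u v : E) :
    christoffel G y u v = (G y).inverse (christoffelFirst G y u v) := rfl

/-- The Riemann curvature tensor in coordinates,
`R(u, v) w = ∂_u Γ(v, w) - ∂_v Γ(u, w) + Γ(u, Γ(v, w)) - Γ(v, Γ(u, w))`, which is
`∇_u ∇_v w - ∇_v ∇_u w` for constant vector fields `u, v, w`. -/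
def curvature (G : E → E →L[ℝ] E →L[ℝ] ℝ) (y : E) : E →L[ℝ] E →L[ℝ] E →L[ℝ] E :=
  let D : E →L[ℝ] E →L[ℝ] E →L[ℝ] E := fderiv ℝ (christoffel G) y
  let Q : E →L[ℝ] E →L[ℝ] E →L[ℝ] E :=
    (ContinuousLinearMap.compL ℝ E E E).bilinearComp (christoffel G y) (christoffel G y)
  D - D.flip + Q - Q.flip

theorem curvature_apply (G : E → E →L[ℝ] E →L[ℝ] ℝ) (y u v w : E) :
    curvature G y u v w =
      fderiv ℝ (christoffel G) y u v w - fderiv ℝ (christoffel G) y v u w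
        + christoffel G y u (christoffel G y v w) - christoffel G y v (christoffel G y u w) := rfl

end Coordinates

/-! ### Algebra of curvature tensors: Ricci, scalar and Weyl curvature -/

section Algebra

variable {V : Type*} [NormedAddCommGroup V] [NormedSpace ℝ V]

/-- The `(0,4)` curvature tensor `Rm(u, v, w, z) = b(R(u, v) z, w)`, with the sign for which
`Rm(u, v, u, v) > 0` on round spheres. -/
def lowered (b : V →L[ℝ] V →L[ℝ] ℝ) (R : V →L[ℝ] V →L[ℝ] V →L[ℝ] V) (u v w z : V) : ℝ :=
  b (R u v z) w

/-- The Ricci tensor `Ric(u, v) = tr (w ↦ R(w, u) v)`. -/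
def ricci (R : V →L[ℝ] V →L[ℝ] V →L[ℝ] V) : V →ₗ[ℝ] V →ₗ[ℝ] ℝ :=
  LinearMap.mk₂ ℝ (fun u v => LinearMap.trace ℝ V ((R.flip u).flip v : V →L[ℝ] V))
    (by intros; simp) (by intros; simp) (by intros; simp) (by intros; simp)

/-- The scalar curvature, the trace of the Ricci tensor with one index raised by `b`. -/
def scalar [FiniteDimensional ℝ V] (b : V →L[ℝ] V →L[ℝ] ℝ)
    (R : V →L[ℝ] V →L[ℝ] V →L[ℝ] V) : ℝ :=
  LinearMap.trace ℝ V
    ((b.inverse : (V →L[ℝ] ℝ) →ₗ[ℝ] V) ∘ₗ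
      (LinearMap.toContinuousLinearMap : (V →ₗ[ℝ] ℝ) ≃ₗ[ℝ] (V →L[ℝ] ℝ)).toLinearMap ∘ₗ ricci R)

/-- The Kulkarni–Nomizu product of two symmetric bilinear forms. -/
def kulkarniNomizu (A B : V → V → ℝ) (x y z t : V) : ℝ :=
  (A x z * B y t - B x t * A y z) + (B x z * A y t - A x t * B y z)

/-- The trace-free Ricci tensor `Ric - (s / n) b`. -/
def tracefreeRicci [FiniteDimensional ℝ V] (b : V →L[ℝ] V →L[ℝ] ℝ)
    (R : V →L[ℝ] V →L[ℝ] V →L[ℝ] V) (u v : V) : ℝ :=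
  ricci R u v - scalar b R / Module.finrank ℝ V * b u v

/-- The Weyl tensor: what is left of the `(0,4)` curvature tensor in dimension `n` after
subtracting `s / (2 n (n - 1)) b ∧ b` and `1 / (n - 2) Ric₀ ∧ b`. -/
def weyl [FiniteDimensional ℝ V] (b : V →L[ℝ] V →L[ℝ] ℝ)
    (R : V →L[ℝ] V →L[ℝ] V →L[ℝ] V) (u v w z : V) : ℝ :=
  let n : ℝ := Module.finrank ℝ V
  lowered b R u v w z
    - scalar b R / (2 * n * (n - 1)) *
      kulkarniNomizu (fun p q => b p q) (fun p q => b p q) u v w z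
    - 1 / (n - 2) * kulkarniNomizu (tracefreeRicci b R) (fun p q => b p q) u v w z

end Algebra

/-! ### Two-forms on an oriented four-dimensional Euclidean space -/

section TwoForms

variable {V : Type*} [NormedAddCommGroup V] [NormedSpace ℝ V]

/-- Positively oriented `b`-orthonormal bases. -/
def IsOrientedOrthonormal (b : V →L[ℝ] V →L[ℝ] ℝ) (o : Orientation ℝ V (Fin 4))
    (e : Module.Basis (Fin 4) ℝ V) : Prop :=
  (∀ i j, b (e i) (e j) = if i = j then 1 else 0) ∧ e.orientation = o

/-- The inner product of two-forms for which the `eⁱ ∧ eʲ`, `i < j`, are orthonormal, where `e`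
is an orthonormal basis. It does not depend on `e`. -/
def formInner (e : Module.Basis (Fin 4) ℝ V) (α β : V [⋀^Fin 2]→ₗ[ℝ] ℝ) : ℝ :=
  ∑ i, ∑ j ∈ Finset.Ioi i, α ![e i, e j] * β ![e i, e j]

/-- The value `(α ∧ β)(u, v, w, z)` of the wedge product of two two-forms. -/
def wedgeApply (α β : V [⋀^Fin 2]→ₗ[ℝ] ℝ) (u v w z : V) : ℝ :=
  α ![u, v] * β ![w, z] - α ![u, w] * β ![v, z] + α ![u, z] * β ![v, w]
    + α ![v, w] * β ![u, z] - α ![v, z] * β ![u, w] + α ![w, z] * β ![u, v]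

/-- `β = *α`, where the Hodge star is determined by `⟨γ, α⟩ ω = γ ∧ *α` for all two-forms `γ`,
with `ω` the volume form, which takes the value `1` on positively oriented orthonormal bases. -/
def IsHodgeStar (b : V →L[ℝ] V →L[ℝ] ℝ) (o : Orientation ℝ V (Fin 4))
    (α β : V [⋀^Fin 2]→ₗ[ℝ] ℝ) : Prop :=
  ∀ e : Module.Basis (Fin 4) ℝ V, IsOrientedOrthonormal b o e →
    ∀ γ : V [⋀^Fin 2]→ₗ[ℝ] ℝ, formInner e γ α = wedgeApply γ β (e 0) (e 1) (e 2) (e 3)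

/-- The eigenspace `Λ²₋` of the Hodge star for the eigenvalue `-1`. -/
def antiSelfDualForms (b : V →L[ℝ] V →L[ℝ] ℝ) (o : Orientation ℝ V (Fin 4)) :
    Set (V [⋀^Fin 2]→ₗ[ℝ] ℝ) :=
  {α | IsHodgeStar b o α (-α)}

/-- `⟨W α, β⟩`, where a `(0,4)` tensor `W` acts on two-forms by
`(W α)(u, v) = ∑_{k < l} W(u, v, e_k, e_l) α(e_k, e_l)` for an orthonormal basis `e`. -/
def operatorInner (e : Module.Basis (Fin 4) ℝ V) (W : V → V → V → V → ℝ)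
    (α β : V [⋀^Fin 2]→ₗ[ℝ] ℝ) : ℝ :=
  ∑ i, ∑ j ∈ Finset.Ioi i, ∑ k, ∑ l ∈ Finset.Ioi k,
    W (e i) (e j) (e k) (e l) * α ![e k, e l] * β ![e i, e j]

end TwoForms

/-! ### Curvature on manifolds without boundary -/

section Manifold

variable {E : Type*} [NormedAddCommGroup E] [NormedSpace ℝ E]
  {H : Type*} [TopologicalSpace H] (I : ModelWithCorners ℝ E H)
  (M : Type*) [TopologicalSpace M] [ChartedSpace H M]

/-- Fields of bilinear forms on the tangent spaces of `M`. -/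
abbrev BilinField : Type _ := (x : M) → TangentSpace I x →L[ℝ] TangentSpace I x →L[ℝ] ℝ

/-- Smooth Riemannian metrics on `M`. -/
abbrev SmoothMetric [IsManifold I ∞ M] : Type _ :=
  ContMDiffRiemannianMetric I ∞ E (fun x : M => TangentSpace I x)

variable {I M}

/-- The coordinate expression of `g` in the chart around `x₀`: its pullback under the inverse of
the chart. -/
def inChart (g : BilinField I M) (x₀ : M) (y : E) : E →L[ℝ] E →L[ℝ] ℝ :=
  let D : E →L[ℝ] E := mfderiv 𝓘(ℝ, E) I (extChartAt I x₀).symm y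
  let B : E →L[ℝ] E →L[ℝ] ℝ := g ((extChartAt I x₀).symm y)
  B.bilinearComp D D

/-- The Riemann curvature tensor of `g` at `x`, computed in the preferred chart around `x`, by
which Mathlib identifies the tangent space at `x` with the model space `E`. -/
def riemann (g : BilinField I M) (x : M) :
    TangentSpace I x →L[ℝ] TangentSpace I x →L[ℝ] TangentSpace I x →L[ℝ] TangentSpace I x :=
  curvature (E := E) (inChart g x) (extChartAt I x x)

/-- The sectional curvature of the plane spanned by two linearly independent vectors. -/
def sectionalCurvature (g : BilinField I M) (x : M) (u v : TangentSpace I x) : ℝ :=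
  lowered (V := E) (g x) (riemann g x) u v u v / (g x u u * g x v v - g x u v ^ 2)

/-- All sectional curvatures of `g` at all points of `U` are equal to `c`. -/
def HasConstantCurvatureOn (g : BilinField I M) (c : ℝ) (U : Set M) : Prop :=
  ∀ x ∈ U, ∀ u v : TangentSpace I x, LinearIndependent ℝ ![u, v] →
    sectionalCurvature g x u v = c

/-- Hyperbolic metrics: constant sectional curvature `-1`. -/
def IsHyperbolic (g : BilinField I M) : Prop := HasConstantCurvatureOn g (-1) univ

/-- Locally conformally flat: every point has an open neighbourhood `U` with a smooth `f > 0` on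
`U` such that `f g` has zero sectional curvature everywhere on `U`. -/
def IsLocallyConformallyFlat (g : BilinField I M) : Prop :=
  ∀ p : M, ∃ U : Set M, IsOpen U ∧ p ∈ U ∧ ∃ f : M → ℝ,
    ContMDiffOn I 𝓘(ℝ, ℝ) ∞ f U ∧ (∀ x ∈ U, 0 < f x) ∧
      HasConstantCurvatureOn (fun x => f x • g x) 0 U

/-- The Weyl tensor of `g` at `x`. -/
def weylTensor [FiniteDimensional ℝ E] (g : BilinField I M) (x : M)
    (u v w z : TangentSpace I x) : ℝ :=
  weyl (V := E) (g x) (riemann g x) u v w z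

variable (I M) in
/-- An orientation of an `n`-dimensional manifold: an orientation of every tangent space, locally
constant when read in the trivializations of the tangent bundle that are given by charts. -/
structure ManifoldOrientation [IsManifold I 1 M] (n : ℕ) where
  /-- The orientation of the tangent space at `x`. -/
  orient (x : M) : Orientation ℝ (TangentSpace I x) (Fin n)
  locallyConstant (x₀ : M) : ∃ c : Orientation ℝ E (Fin n), ∀ᶠ x in 𝓝 x₀,
    ∀ hx : x ∈ (trivializationAt E (TangentSpace I : M → Type _) x₀).baseSet,
      Orientation.map (Fin n)
        ((trivializationAt E (TangentSpace I : M → Type _) x₀).continuousLinearEquivAt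
          ℝ x hx).toLinearEquiv (orient x) = c

/-- A metric on an oriented four-manifold is self-dual if `W₋`, the block `Λ²₋ → Λ²₋` of its Weyl
tensor as an operator on two-forms, vanishes identically, i.e. `⟨W α, β⟩ = 0` for all
`α, β ∈ Λ²₋` at all points. -/
def IsSelfDual [FiniteDimensional ℝ E] [IsManifold I 1 M] (g : BilinField I M)
    (o : ManifoldOrientation I M 4) : Prop :=
  ∀ (x : M) (e : Module.Basis (Fin 4) ℝ E),
    IsOrientedOrthonormal (V := E) (g x) (o.orient x) e →
    ∀ α ∈ antiSelfDualForms (V := E) (g x) (o.orient x),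
    ∀ β ∈ antiSelfDualForms (V := E) (g x) (o.orient x),
      operatorInner (V := E) e (weylTensor g x) α β = 0

end Manifold

/-! ### The product metric -/

section Product

variable {E : Type*} [NormedAddCommGroup E] [NormedSpace ℝ E]
  {H : Type*} [TopologicalSpace H] {I : ModelWithCorners ℝ E H}
  {M : Type*} [TopologicalSpace M] [ChartedSpace H M]
  {E' : Type*} [NormedAddCommGroup E'] [NormedSpace ℝ E']
  {H' : Type*} [TopologicalSpace H'] {I' : ModelWithCorners ℝ E' H'}
  {M' : Type*} [TopologicalSpace M'] [ChartedSpace H' M']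

/-- The pullback of a field of bilinear forms under a map. -/
def pullback (f : M → M') (g : BilinField I' M') : BilinField I M := fun x =>
  let D : E →L[ℝ] E' := mfderiv I I' f x
  let B : E' →L[ℝ] E' →L[ℝ] ℝ := g (f x)
  let P : E →L[ℝ] E →L[ℝ] ℝ := B.bilinearComp D D
  P

theorem contMDiff_pullback [IsManifold I ∞ M] [IsManifold I' ∞ M'] {f : M → M'}
    (hf : ContMDiff I I' ∞ f) {g : BilinField I' M'}
    (hg : ContMDiff I' (I'.prod 𝓘(ℝ, E' →L[ℝ] E' →L[ℝ] ℝ)) ∞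
      (fun b ↦ TotalSpace.mk' (E' →L[ℝ] E' →L[ℝ] ℝ)
        (E := fun b : M' => TangentSpace I' b →L[ℝ] TangentSpace I' b →L[ℝ] ℝ) b (g b))) :
    ContMDiff I (I.prod 𝓘(ℝ, E →L[ℝ] E →L[ℝ] ℝ)) ∞
      (fun b ↦ TotalSpace.mk' (E →L[ℝ] E →L[ℝ] ℝ)
        (E := fun b : M => TangentSpace I b →L[ℝ] TangentSpace I b →L[ℝ] ℝ) b
          (pullback (I := I) f g b)) := by
  intro x₀
  have hdf := (hf x₀).mfderiv_const (m := ∞) (by simp)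
  have hgx := (contMDiffAt_hom_bundle _).1 (hg (f x₀))
  have hc := hgx.2.comp x₀ (hf x₀)
  refine (contMDiffAt_hom_bundle _).2 ⟨contMDiffAt_id, ?_⟩
  set A : M → E →L[ℝ] E' := inTangentCoordinates I I' id f (mfderiv I I' f) x₀ with hA
  set C : M → E' →L[ℝ] E' →L[ℝ] ℝ := fun x => ContinuousLinearMap.inCoordinates E'
    (TangentSpace I' : M' → Type _) (E' →L[ℝ] ℝ) (fun b : M' => TangentSpace I' b →L[ℝ] ℝ)
      (f x₀) (f x) (f x₀) (f x) (g (f x)) with hC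
  have key : ContMDiffAt I 𝓘(ℝ, E →L[ℝ] E →L[ℝ] ℝ) ∞
      (fun x => (((ContinuousLinearMap.compL ℝ E E' ℝ).flip (A x)).comp ((C x).comp (A x)))) x₀ := by
    have hc' : ContMDiffAt I 𝓘(ℝ, E' →L[ℝ] E' →L[ℝ] ℝ) ∞ C x₀ := hc
    have h1 := hc'.clm_comp hdf
    refine ContMDiffAt.clm_comp ?_ h1
    exact ((ContinuousLinearMap.compL ℝ E E' ℝ).flip.contMDiff).contMDiffAt.comp x₀ hdf
  refine key.congr_of_eventuallyEq ?_
  have n1 : ∀ᶠ x in 𝓝 x₀, x ∈ (trivializationAt E (TangentSpace I : M → Type _) x₀).baseSet :=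
    (trivializationAt E (TangentSpace I : M → Type _) x₀).open_baseSet.mem_nhds
      (FiberBundle.mem_baseSet_trivializationAt' x₀)
  have n2 : ∀ᶠ x in 𝓝 x₀, f x ∈
      (trivializationAt E' (TangentSpace I' : M' → Type _) (f x₀)).baseSet :=
    (hf.continuous.continuousAt).eventually
      ((trivializationAt E' (TangentSpace I' : M' → Type _) (f x₀)).open_baseSet.mem_nhds
        (FiberBundle.mem_baseSet_trivializationAt' (f x₀)))
  filter_upwards [n1, n2] with x h1 h2
  ext u v
  refine (inCoordinates_apply_eq₂ h1 h1 (mem_univ _)).trans ?_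
  have hCx := fun p q => inCoordinates_apply_eq₂ (F₃ := ℝ) (E₃ := fun _ : M' => ℝ)
    (ϕ := g (f x)) (v := p) (w := q) h2 h2 (mem_univ _)
  have hAx : ∀ w, (trivializationAt E' (TangentSpace I' : M' → Type _) (f x₀)).symm (f x) (A x w) =
    mfderiv I I' f x ((trivializationAt E (TangentSpace I : M → Type _) x₀).symm x w) := by
    intro w
    have h3 := (trivializationAt E' (TangentSpace I' : M' → Type _) (f x₀)).symmL_apply
      (R := ℝ) h2 (A x w)
    have h4 := (trivializationAt E (TangentSpace I : M → Type _) x₀).symmL_apply (R := ℝ) h1 w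
    rw [← h3, ← h4]
    exact (trivializationAt E' (TangentSpace I' : M' → Type _) (f x₀)).symmL_continuousLinearMapAt
      (R := ℝ) h2 _
  refine Eq.trans ?_ (hCx (A x u) (A x v)).symm
  rw [hAx, hAx]
  rfl

theorem pullback_fst_apply (g : BilinField I M) (p : M × M')
    (u v : TangentSpace (I.prod I') p) :
    pullback (I := I.prod I') Prod.fst g p u v = g p.1 u.1 v.1 := by
  have h : mfderiv (I.prod I') I Prod.fst p = ContinuousLinearMap.fst ℝ E E' := mfderiv_fst
  change g p.1 (mfderiv (I.prod I') I Prod.fst p u) (mfderiv (I.prod I') I Prod.fst p v) = _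
  rw [h]
  rfl

theorem pullback_snd_apply (g : BilinField I' M') (p : M × M')
    (u v : TangentSpace (I.prod I') p) :
    pullback (I := I.prod I') Prod.snd g p u v = g p.2 u.2 v.2 := by
  have h : mfderiv (I.prod I') I' Prod.snd p = ContinuousLinearMap.snd ℝ E E' := mfderiv_snd
  change g p.2 (mfderiv (I.prod I') I' Prod.snd p u) (mfderiv (I.prod I') I' Prod.snd p v) = _
  rw [h]
  rfl

theorem pullback_add_apply (g₁ : BilinField I M) (g₂ : BilinField I' M') (p : M × M')
    (u v : TangentSpace (I.prod I') p) :
    (pullback (I := I.prod I') Prod.fst g₁ p + pullback (I := I.prod I') Prod.snd g₂ p) u v =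
      g₁ p.1 u.1 v.1 + g₂ p.2 u.2 v.2 :=
  congrArg₂ (· + ·) (pullback_fst_apply g₁ p u v) (pullback_snd_apply g₂ p u v)

theorem SmoothMetric.nonneg [IsManifold I ∞ M] (g : SmoothMetric I M) (x : M)
    (w : TangentSpace I x) : 0 ≤ g.inner x w w := by
  by_cases hw : w = 0
  · simp [hw]
  · exact (g.pos x w hw).le

/-- The product metric `π₁^* g₁ + π₂^* g₂` on `M × M'`, for which
`⟨(u₁, u₂), (v₁, v₂)⟩ = g₁(u₁, v₁) + g₂(u₂, v₂)`. -/
def productMetric [IsManifold I ∞ M] [IsManifold I' ∞ M'] (g₁ : SmoothMetric I M)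
    (g₂ : SmoothMetric I' M') : SmoothMetric (I.prod I') (M × M') where
  inner p := pullback (I := I.prod I') Prod.fst g₁.inner p +
    pullback (I := I.prod I') Prod.snd g₂.inner p
  symm p u v := by
    refine (pullback_add_apply g₁.inner g₂.inner p u v).trans
      (Eq.trans ?_ (pullback_add_apply g₁.inner g₂.inner p v u).symm)
    exact congrArg₂ (· + ·) (g₁.symm p.1 u.1 v.1) (g₂.symm p.2 u.2 v.2)
  pos p u hu := by
    refine lt_of_lt_of_eq ?_ (pullback_add_apply g₁.inner g₂.inner p u u).symm
    by_cases h₁ : u.1 = 0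
    · have h₂ : u.2 ≠ 0 := fun h₂ => hu (Prod.ext h₁ h₂)
      exact add_pos_of_nonneg_of_pos (g₁.nonneg p.1 u.1) (g₂.pos p.2 u.2 h₂)
    · exact add_pos_of_pos_of_nonneg (g₁.pos p.1 u.1 h₁) (g₂.nonneg p.2 u.2)
  isVonNBounded p := by
    have b₁ : Bornology.IsBounded {v : E | g₁.inner p.1 v v < 1} :=
      (NormedSpace.isVonNBounded_iff ℝ).1 (g₁.isVonNBounded p.1)
    have b₂ : Bornology.IsBounded {v : E' | g₂.inner p.2 v v < 1} :=
      (NormedSpace.isVonNBounded_iff ℝ).1 (g₂.isVonNBounded p.2)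
    refine (NormedSpace.isVonNBounded_iff (E := E × E') ℝ).2 ((b₁.prod b₂).subset ?_)
    intro u hu
    have hu' : g₁.inner p.1 u.1 u.1 + g₂.inner p.2 u.2 u.2 < 1 :=
      lt_of_eq_of_lt (pullback_add_apply g₁.inner g₂.inner p u u).symm hu
    exact ⟨(le_add_of_nonneg_right (g₂.nonneg p.2 u.2)).trans_lt hu',
      (le_add_of_nonneg_left (g₁.nonneg p.1 u.1)).trans_lt hu'⟩
  contMDiff := ContMDiff.add_section (contMDiff_pullback contMDiff_fst g₁.contMDiff)
    (contMDiff_pullback contMDiff_snd g₂.contMDiff)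

theorem productMetric_apply [IsManifold I ∞ M] [IsManifold I' ∞ M'] (g₁ : SmoothMetric I M)
    (g₂ : SmoothMetric I' M') (p : M × M') (u v : TangentSpace (I.prod I') p) :
    (productMetric g₁ g₂).inner p u v = g₁.inner p.1 u.1 v.1 + g₂.inner p.2 u.2 v.2 :=
  pullback_add_apply g₁.inner g₂.inner p u v

end Product

/-! ### Closed surfaces and their genus -/

section Surfaces

universe u

/-- The rank of the first singular homology group with integer coefficients. -/
def firstBettiNumber (X : Type u) [TopologicalSpace X] : ℕ :=
  Module.finrank ℤ
    ((((AlgebraicTopology.singularHomologyFunctor (ModuleCat.{u} ℤ) 1).obj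
      (ModuleCat.of ℤ (ULift.{u} ℤ))).obj (TopCat.of X) : ModuleCat.{u} ℤ) : Type u)

/-- A smooth surface (without boundary) that is closed, connected and orientable, and has genus
`k`, i.e. first Betti number `2 k`. -/
structure IsClosedSurfaceOfGenus (k : ℕ) (S : Type u) [TopologicalSpace S]
    [ChartedSpace (EuclideanSpace ℝ (Fin 2)) S] [IsManifold (𝓡 2) ∞ S] : Prop where
  hausdorff : T2Space S
  compact : CompactSpace S
  connected : ConnectedSpace S
  orientable : Nonempty (ManifoldOrientation (𝓡 2) S 2)
  genus : firstBettiNumber S = 2 * k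

end Surfaces

end HyperbolicProduct
end

/-!
Conformal flatness and self-duality both force an algebraic identity on the curvature tensor at each
point, and the curvature tensor of a product of hyperbolic surfaces violates both identities.

*Curvature of the product.* In a product chart the metric is block diagonal, so its Christoffel
symbols and its curvature tensor are direct sums (`riemann_productMetric`). In dimension two,
sectional curvature `-1` determines the whole curvature tensor
(`eq_of_sectional_eq_neg_one`). Hence, in an orthonormal basis `e₀, e₁, e₂, e₃` with `e₀, e₁`
tangent to the first factor and `e₂, e₃` tangent to the second, the planes `e₀e₁` and `e₂e₃` have
sectional curvature `-1` and the mixed planes are flat (`IsHyperbolicSum.lowered_adapted`).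

*Conformal flatness.* If `F G` is flat, the conformal transformation law of the curvature
(`IsMetricGerm.exists_lowered_curvature_smul`) shows that the sectional curvature of `G` on an
orthonormal pair `u, v` has the form `A(u) + A(v)`. Then the planes `e₀e₁, e₂e₃` and the planes
`e₀e₂, e₁e₃` have the same total curvature, whereas here the totals are `-2` and `0`.

*Self-duality.* The product is Einstein with `Ric = -γ` (`IsHyperbolicSum.ricci_eq`), so that its
Weyl tensor is `Rm` plus a multiple of the Kulkarni–Nomizu square of `γ`. For either orientation,
the signs of the `eᵢ` can be chosen so that the basis is positively oriented. The form
`α = e⁰ ∧ e¹ - e² ∧ e³` is then anti-self-dual (`antiForm_mem_antiSelfDualForms`), and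
`⟨W α, α⟩ = -4 / 3` (`IsHyperbolicSum.operatorInner_weyl`).
-/

noncomputable section

namespace HyperbolicProduct

/-! ### Christoffel symbols of a metric germ -/

section Germ

variable {E : Type*} [NormedAddCommGroup E] [NormedSpace ℝ E]

/-- `G` is a metric of class `C²` near `y`, in coordinates. Of positivity only nondegeneracy is
kept, in the form in which it enters the Christoffel symbols. -/
structure IsMetricGerm (G : E → E →L[ℝ] E →L[ℝ] ℝ) (y : E) : Prop where
  contDiffAt : ContDiffAt ℝ 2 G y
  symm : ∀ᶠ z in 𝓝 y, ∀ u v, G z u v = G z v u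
  isInvertible : ∀ᶠ z in 𝓝 y, (G z).IsInvertible

variable {G : E → E →L[ℝ] E →L[ℝ] ℝ} {y : E}

theorem IsMetricGerm.eventually (hG : IsMetricGerm G y) :
    ∀ᶠ z in 𝓝 y, IsMetricGerm G z := by
  filter_upwards [hG.contDiffAt.eventually (by simp), hG.symm.eventually_nhds,
    hG.isInvertible.eventually_nhds] with z h₁ h₂ h₃
  exact ⟨h₁, h₂, h₃⟩

theorem IsMetricGerm.differentiableAt (hG : IsMetricGerm G y) : DifferentiableAt ℝ G y :=
  hG.contDiffAt.differentiableAt (by simp)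

theorem fderiv_apply₂ {F : Type*} [NormedAddCommGroup F] [NormedSpace ℝ F]
    {B : E → E →L[ℝ] E →L[ℝ] F} (hB : DifferentiableAt ℝ B y) (u v w : E) :
    fderiv ℝ B y u v w = fderiv ℝ (fun z => B z v w) y u := by
  have h := ((hB.hasFDerivAt.clm_apply (hasFDerivAt_const v y)).clm_apply
    (hasFDerivAt_const w y)).fderiv
  rw [h]
  simp

theorem differentiableAt_apply₂ {F : Type*} [NormedAddCommGroup F] [NormedSpace ℝ F]
    {B : E → E →L[ℝ] E →L[ℝ] F} (hB : DifferentiableAt ℝ B y) (v w : E) :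
    DifferentiableAt ℝ (fun z => B z v w) y :=
  ((hB.hasFDerivAt.clm_apply (hasFDerivAt_const v y)).clm_apply
    (hasFDerivAt_const w y)).differentiableAt

theorem IsMetricGerm.fderiv_symm (hG : IsMetricGerm G y) (u v w : E) :
    fderiv ℝ G y u v w = fderiv ℝ G y u w v := by
  rw [fderiv_apply₂ hG.differentiableAt, fderiv_apply₂ hG.differentiableAt]
  congr 1
  exact Filter.EventuallyEq.fderiv_eq (hG.symm.mono fun z hz => hz v w)

theorem IsMetricGerm.apply_inverse (hG : IsMetricGerm G y) (φ : E →L[ℝ] ℝ) :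
    G y ((G y).inverse φ) = φ :=
  hG.isInvertible.self_of_nhds.self_apply_inverse φ

theorem IsMetricGerm.ext (hG : IsMetricGerm G y) {a b : E} (h : ∀ w, G y a w = G y b w) :
    a = b :=
  hG.isInvertible.self_of_nhds.injective (ContinuousLinearMap.ext h)

theorem IsMetricGerm.apply_christoffel (hG : IsMetricGerm G y) (u v w : E) :
    G y (christoffel G y u v) w = christoffelFirst G y u v w := by
  rw [christoffel_apply, hG.apply_inverse]

theorem IsMetricGerm.christoffel_symm (hG : IsMetricGerm G y) (u v : E) :
    christoffel G y u v = christoffel G y v u := by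
  refine hG.ext fun w => ?_
  rw [hG.apply_christoffel, hG.apply_christoffel, christoffelFirst_apply, christoffelFirst_apply,
    hG.fderiv_symm w u v]
  ring

/-- The Levi-Civita connection is metric. -/
theorem IsMetricGerm.fderiv_eq (hG : IsMetricGerm G y) (u v w : E) :
    fderiv ℝ G y u v w = G y (christoffel G y u v) w + G y (christoffel G y u w) v := by
  rw [hG.apply_christoffel, hG.apply_christoffel, christoffelFirst_apply, christoffelFirst_apply,
    hG.fderiv_symm u w v]
  ring

theorem IsMetricGerm.differentiableAt_inverse [CompleteSpace E] (hG : IsMetricGerm G y) :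
    DifferentiableAt ℝ (fun z => (G z).inverse) y :=
  ((hG.isInvertible.self_of_nhds.contDiffAt_map_inverse (n := 1)).comp y
    (hG.contDiffAt.of_le (by norm_num))).differentiableAt (by simp)

theorem IsMetricGerm.differentiableAt_fderiv (hG : IsMetricGerm G y) :
    DifferentiableAt ℝ (fderiv ℝ G) y :=
  (hG.contDiffAt.fderiv_right (m := 1) (by norm_num)).differentiableAt (by simp)

theorem IsMetricGerm.differentiableAt_christoffel [CompleteSpace E] (hG : IsMetricGerm G y) :
    DifferentiableAt ℝ (christoffel G) y := by
  have h₁ : DifferentiableAt ℝ (christoffelFirst G) y := by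
    have hD := hG.differentiableAt_fderiv
    have hf : DifferentiableAt ℝ (fun z => (fderiv ℝ G z).flip) y :=
      (ContinuousLinearMap.flipₗᵢ ℝ E E (E →L[ℝ] ℝ)).differentiable.differentiableAt.comp y hD
    have hc := (differentiableAt_const (x := y)
      ((ContinuousLinearMap.flipₗᵢ ℝ E E ℝ).toContinuousLinearEquiv :
        (E →L[ℝ] E →L[ℝ] ℝ) →L[ℝ] (E →L[ℝ] E →L[ℝ] ℝ))).clm_comp hf
    exact ((hD.add hf).sub hc).const_smul (1 / 2 : ℝ)
  have h₂ : DifferentiableAt ℝ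
      (fun z => ContinuousLinearMap.compL ℝ E (E →L[ℝ] ℝ) E (G z).inverse) y :=
    (ContinuousLinearMap.compL ℝ E (E →L[ℝ] ℝ) E).differentiableAt.comp y
      hG.differentiableAt_inverse
  exact h₂.clm_comp h₁

/-! ### Curvature of a product -/

variable {E' : Type*} [NormedAddCommGroup E'] [NormedSpace ℝ E']

/-- Near `p`, the metric `G` is the orthogonal sum of the metrics `G₁` and `G₂`. -/
def IsProductNear (G : E × E' → E × E' →L[ℝ] E × E' →L[ℝ] ℝ) (G₁ : E → E →L[ℝ] E →L[ℝ] ℝ)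
    (G₂ : E' → E' →L[ℝ] E' →L[ℝ] ℝ) (p : E × E') : Prop :=
  ∀ᶠ z in 𝓝 p, ∀ u v, G z u v = G₁ z.1 u.1 v.1 + G₂ z.2 u.2 v.2

variable {P : E × E' → E × E' →L[ℝ] E × E' →L[ℝ] ℝ} {G₁ : E → E →L[ℝ] E →L[ℝ] ℝ}
    {G₂ : E' → E' →L[ℝ] E' →L[ℝ] ℝ} {p : E × E'}

theorem IsProductNear.fderiv_apply (h : IsProductNear P G₁ G₂ p) (hP : IsMetricGerm P p)
    (h₁ : IsMetricGerm G₁ p.1) (h₂ : IsMetricGerm G₂ p.2) (u v w : E × E') :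
    fderiv ℝ P p u v w = fderiv ℝ G₁ p.1 u.1 v.1 w.1 + fderiv ℝ G₂ p.2 u.2 v.2 w.2 := by
  rw [fderiv_apply₂ hP.differentiableAt, fderiv_apply₂ h₁.differentiableAt,
    fderiv_apply₂ h₂.differentiableAt,
    Filter.EventuallyEq.fderiv_eq (h.mono fun z hz => hz v w)]
  have e₁ := (differentiableAt_apply₂ h₁.differentiableAt v.1 w.1).hasFDerivAt.comp p
    (hasFDerivAt_fst (𝕜 := ℝ))
  have e₂ := (differentiableAt_apply₂ h₂.differentiableAt v.2 w.2).hasFDerivAt.comp p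
    (hasFDerivAt_snd (𝕜 := ℝ))
  have e := (e₁.add e₂).fderiv
  exact congrArg (fun L => L u) e

theorem IsProductNear.christoffel (h : IsProductNear P G₁ G₂ p) (hP : IsMetricGerm P p)
    (h₁ : IsMetricGerm G₁ p.1) (h₂ : IsMetricGerm G₂ p.2) (u v : E × E') :
    christoffel P p u v = (christoffel G₁ p.1 u.1 v.1, christoffel G₂ p.2 u.2 v.2) := by
  refine hP.ext fun w => ?_
  rw [hP.apply_christoffel, h.self_of_nhds, h₁.apply_christoffel, h₂.apply_christoffel]
  simp only [christoffelFirst_apply, h.fderiv_apply hP h₁ h₂]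
  ring

/-- The curvature tensor of a product is the direct sum of the curvature tensors. -/
theorem IsProductNear.curvature [CompleteSpace E] [CompleteSpace E']
    (h : IsProductNear P G₁ G₂ p) (hP : IsMetricGerm P p)
    (h₁ : IsMetricGerm G₁ p.1) (h₂ : IsMetricGerm G₂ p.2) (u v w : E × E') :
    curvature P p u v w = (curvature G₁ p.1 u.1 v.1 w.1, curvature G₂ p.2 u.2 v.2 w.2) := by
  have key : ∀ v w : E × E', (fun z => HyperbolicProduct.christoffel P z v w) =ᶠ[𝓝 p]
      fun z => (HyperbolicProduct.christoffel G₁ z.1 v.1 w.1,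
        HyperbolicProduct.christoffel G₂ z.2 v.2 w.2) := fun v w => by
    filter_upwards [hP.eventually, continuousAt_fst.eventually h₁.eventually,
      continuousAt_snd.eventually h₂.eventually, h.eventually_nhds] with z k k₁ k₂ k₃
    exact IsProductNear.christoffel k₃ k k₁ k₂ v w
  have hD : ∀ u v w : E × E', fderiv ℝ (HyperbolicProduct.christoffel P) p u v w =
      (fderiv ℝ (HyperbolicProduct.christoffel G₁) p.1 u.1 v.1 w.1,
        fderiv ℝ (HyperbolicProduct.christoffel G₂) p.2 u.2 v.2 w.2) := fun u v w => by
    rw [fderiv_apply₂ hP.differentiableAt_christoffel,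
      fderiv_apply₂ h₁.differentiableAt_christoffel,
      fderiv_apply₂ h₂.differentiableAt_christoffel, (key v w).fderiv_eq]
    have e₁ := (differentiableAt_apply₂ h₁.differentiableAt_christoffel v.1 w.1).hasFDerivAt.comp p
      (hasFDerivAt_fst (𝕜 := ℝ))
    have e₂ := (differentiableAt_apply₂ h₂.differentiableAt_christoffel v.2 w.2).hasFDerivAt.comp p
      (hasFDerivAt_snd (𝕜 := ℝ))
    exact congrArg (fun L => L u) (e₁.prodMk e₂).fderiv
  simp only [curvature_apply, hD, h.christoffel hP h₁ h₂, Prod.mk_add_mk, Prod.mk_sub_mk]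

end Germ

/-! ### Conformal change of a metric -/

section Conformal

variable {E : Type*} [NormedAddCommGroup E] [NormedSpace ℝ E]
  {G : E → E →L[ℝ] E →L[ℝ] ℝ} {F : E → ℝ} {y : E}

theorem IsMetricGerm.smul (hG : IsMetricGerm G y) (hF : ContDiffAt ℝ 2 F y) (h0 : F y ≠ 0) :
    IsMetricGerm (fun z => F z • G z) y where
  contDiffAt := hF.smul hG.contDiffAt
  symm := hG.symm.mono fun z hz u v => congrArg (F z * ·) (hz u v)
  isInvertible := by
    filter_upwards [hG.isInvertible, hF.continuousAt.eventually_ne h0] with z ⟨e, he⟩ hz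
    exact ⟨e.trans (ContinuousLinearEquiv.smulLeft (Units.mk0 _ hz)), by
      ext; simp [← he, Units.smul_def]⟩

/-- The logarithmic derivative `d(log F) / 2` of a conformal factor. -/
def halfLogDeriv (F : E → ℝ) (z : E) : E →L[ℝ] ℝ := (2 * F z)⁻¹ • fderiv ℝ F z

theorem differentiableAt_halfLogDeriv (hF : ContDiffAt ℝ 2 F y) (h0 : F y ≠ 0) :
    DifferentiableAt ℝ (halfLogDeriv F) y :=
  (((hF.differentiableAt (by simp)).const_mul 2).inv (by simpa using h0)).smul
    ((hF.fderiv_right (m := 1) (by norm_num)).differentiableAt (by simp))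

/-- The Levi-Civita connection of `F G` is
`Γ(u, v) + θ(u) v + θ(v) u - G(u, v) θ^♯` with `θ = d(log F) / 2`. -/
theorem IsMetricGerm.christoffel_smul (hG : IsMetricGerm G y) (hF : ContDiffAt ℝ 2 F y)
    (h0 : F y ≠ 0) (u v : E) :
    christoffel (fun z => F z • G z) y u v = christoffel G y u v + halfLogDeriv F y u • v +
      halfLogDeriv F y v • u - G y u v • (G y).inverse (halfLogDeriv F y) := by
  have hD : ∀ u v w, fderiv ℝ (fun z => F z • G z) y u v w =
      F y * fderiv ℝ G y u v w + fderiv ℝ F y u * G y v w := fun u v w => by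
    have := ((hF.differentiableAt (by simp)).hasFDerivAt.smul
      hG.differentiableAt.hasFDerivAt).fderiv
    exact congrArg (fun L => L u v w) this
  refine (hG.smul hF h0).ext fun w => ?_
  rw [(hG.smul hF h0).apply_christoffel, christoffelFirst_apply, hD, hD, hD]
  have h1 := hG.apply_christoffel u v w
  rw [christoffelFirst_apply] at h1
  have s := hG.symm.self_of_nhds
  simp only [map_add, map_sub, map_smul, add_apply, sub_apply,
    smul_apply, smul_eq_mul, hG.apply_inverse, h1,
    halfLogDeriv]
  field_simp
  ring

/-- Conformal change of the curvature on an orthonormal pair `u, v`: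
`Rm'(u, v, u, v) = F (Rm(u, v, u, v) - A(u) - A(v))`, where `A` is the quadratic form
`∇θ - θ ⊗ θ + |θ|² G / 2` with `θ = d(log F) / 2`. -/
theorem IsMetricGerm.exists_lowered_curvature_smul [CompleteSpace E] (hG : IsMetricGerm G y)
    (hF : ContDiffAt ℝ 2 F y) (h0 : F y ≠ 0) :
    ∃ A : E → ℝ, ∀ u v, G y u u = 1 → G y v v = 1 → G y u v = 0 →
      lowered (F y • G y) (curvature (fun z => F z • G z) y) u v u v =
        F y * (lowered (G y) (curvature G y) u v u v - A u - A v) := by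
  set θ := halfLogDeriv F with hθ
  set X : E → E := fun z => (G z).inverse (θ z) with hX
  have dθ : DifferentiableAt ℝ θ y := differentiableAt_halfLogDeriv hF h0
  have dX : DifferentiableAt ℝ X y := hG.differentiableAt_inverse.clm_apply dθ
  have key : ∀ v w, (fun z => christoffel (fun z => F z • G z) z v w) =ᶠ[𝓝 y]
      fun z => christoffel G z v w + θ z v • w + θ z w • v - G z v w • X z := fun v w => by
    filter_upwards [hG.eventually, hF.eventually (by simp), hF.continuousAt.eventually_ne h0]
      with z k₁ k₂ k₃
    exact k₁.christoffel_smul k₂ k₃ v w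
  have hD : ∀ u v w, fderiv ℝ (christoffel (fun z => F z • G z)) y u v w =
      fderiv ℝ (christoffel G) y u v w + fderiv ℝ θ y u v • w + fderiv ℝ θ y u w • v
        - (G y v w • fderiv ℝ X y u + fderiv ℝ G y u v w • X y) := fun u v w => by
    rw [fderiv_apply₂ (hG.smul hF h0).differentiableAt_christoffel, (key v w).fderiv_eq,
      fderiv_apply₂ hG.differentiableAt_christoffel, fderiv_apply₂ hG.differentiableAt]
    have e₁ := (differentiableAt_apply₂ hG.differentiableAt_christoffel v w).hasFDerivAt
    have e₂ := fun v w : E =>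
      (dθ.hasFDerivAt.clm_apply (hasFDerivAt_const v y)).smul (hasFDerivAt_const w y)
    have e₃ := (differentiableAt_apply₂ hG.differentiableAt v w).hasFDerivAt.smul dX.hasFDerivAt
    have := congrArg (fun L => L u) ((((e₁.add (e₂ v w)).add (e₂ w v)).sub e₃).fderiv)
    refine this.trans ?_
    simp
  have hGX : ∀ w, G y (X y) w = θ y w := fun w => by rw [hX, hG.apply_inverse]
  -- the derivative of `G(X, w) = θ(w)`
  have hDX : ∀ u w, G y (fderiv ℝ X y u) w = fderiv ℝ θ y u w - fderiv ℝ G y u (X y) w :=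
      fun u w => by
    have e₁ := ((hG.differentiableAt.hasFDerivAt.clm_apply dX.hasFDerivAt).clm_apply
      (hasFDerivAt_const w y)).fderiv
    have e₂ := (dθ.hasFDerivAt.clm_apply (hasFDerivAt_const w y)).fderiv
    have e₃ : (fun z => G z (X z) w) =ᶠ[𝓝 y] fun z => θ z w := by
      filter_upwards [hG.eventually] with z hz
      rw [hX, hz.apply_inverse]
    have := congrArg (fun L => L u) (e₁.symm.trans (e₃.fderiv_eq.trans e₂))
    simp at this
    linarith
  refine ⟨fun u => fderiv ℝ θ y u u - θ y (christoffel G y u u) - θ y u ^ 2 + θ y (X y) / 2,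
    fun u v hu hv huv => ?_⟩
  have s := hG.symm.self_of_nhds
  have hvu : G y v u = 0 := (s v u).trans huv
  have hΓ : ∀ v w, christoffel (fun z => F z • G z) y v w =
      christoffel G y v w + θ y v • w + θ y w • v - G y v w • X y :=
    fun v w => (key v w).self_of_nhds
  have c := hG.christoffel_symm v u
  -- derivatives of `X` and of `G` are eliminated by `hDX` and metric compatibility; what remains is
  -- an identity between the values of `θ`, `G` and the Christoffel symbols on `u, v`
  simp only [lowered, curvature_apply, hD, hΓ, map_add, map_sub, map_smul, add_apply, sub_apply,
    smul_apply, smul_eq_mul, hDX, hGX, hG.fderiv_eq, hu, hv, huv, hvu, c,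
    s u (christoffel G y v v), s v (christoffel G y u v), s u (X y), s v (X y)]
  simp only [s _ (X y), hGX]
  ring

end Conformal

/-! ### Coordinate expressions of metrics on manifolds -/

section Charts

variable {E : Type*} [NormedAddCommGroup E] [NormedSpace ℝ E]
  {H : Type*} [TopologicalSpace H] {I : ModelWithCorners ℝ E H} [I.Boundaryless]
  {M : Type*} [TopologicalSpace M] [ChartedSpace H M]

theorem isInvertible_of_pos [FiniteDimensional ℝ E] {b : E →L[ℝ] E →L[ℝ] ℝ}
    (h : ∀ u, u ≠ 0 → 0 < b u u) : b.IsInvertible := by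
  have hinj : Function.Injective b := (injective_iff_map_eq_zero b).2 fun u hu => by
    by_contra h0
    exact (h u h0).ne' (by rw [hu]; rfl)
  let L : E →ₗ[ℝ] (E →ₗ[ℝ] ℝ) :=
    (LinearMap.toContinuousLinearMap : (E →ₗ[ℝ] ℝ) ≃ₗ[ℝ] (E →L[ℝ] ℝ)).symm.toLinearMap ∘ₗ
      (b : E →ₗ[ℝ] (E →L[ℝ] ℝ))
  have hL : Function.Injective L :=
    (LinearMap.toContinuousLinearMap : (E →ₗ[ℝ] ℝ) ≃ₗ[ℝ] (E →L[ℝ] ℝ)).symm.injective.comp hinj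
  let e : E ≃ₗ[ℝ] (E →L[ℝ] ℝ) := (LinearEquiv.ofInjectiveOfFinrankEq L hL
    (Subspace.dual_finrank_eq (K := ℝ) (V := E)).symm).trans LinearMap.toContinuousLinearMap
  exact ⟨e.toContinuousLinearEquiv, by ext; rfl⟩

omit [I.Boundaryless] in
theorem inChart_apply (g : BilinField I M) (x₀ : M) (y u v : E) :
    inChart g x₀ y u v = g ((extChartAt I x₀).symm y)
      (mfderiv 𝓘(ℝ, E) I (extChartAt I x₀).symm y u)
      (mfderiv 𝓘(ℝ, E) I (extChartAt I x₀).symm y v) := rfl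

theorem mdifferentiableAt_extChartAt_symm [IsManifold I 1 M] {x₀ : M} {y : E}
    (hy : y ∈ (extChartAt I x₀).target) :
    MDifferentiableAt 𝓘(ℝ, E) I (extChartAt I x₀).symm y := by
  have h := mdifferentiableWithinAt_extChartAt_symm (I := I) hy
  rwa [I.range_eq_univ, mdifferentiableWithinAt_univ] at h

theorem mfderiv_extChartAt_symm_eq_symmL [IsManifold I 1 M] {x₀ : M} {y : E}
    (hy : y ∈ (extChartAt I x₀).target) :
    mfderiv 𝓘(ℝ, E) I (extChartAt I x₀).symm y =
      (trivializationAt E (TangentSpace I : M → Type _) x₀).symmL ℝ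
        ((extChartAt I x₀).symm y) := by
  have hx := (extChartAt I x₀).map_target hy
  rw [extChartAt_source] at hx
  rw [TangentBundle.symmL_trivializationAt hx, I.range_eq_univ, mfderivWithin_univ,
    (extChartAt I x₀).right_inv hy]

/-- At the centre of the chart, the coordinate expression is the metric itself, as the tangent
space is identified with the model space by this chart. -/
theorem inChart_self [IsManifold I 1 M] (g : BilinField I M) (x : M) :
    inChart g x (extChartAt I x x) = g x := by
  have h := mfderivWithin_range_extChartAt_symm (I := I) (x := x)
  rw [I.range_eq_univ, mfderivWithin_univ] at h
  have key : ∀ z, z = x → ∀ D : E →L[ℝ] E, D = ContinuousLinearMap.id ℝ E → ∀ u v : E,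
      (g z : E →L[ℝ] E →L[ℝ] ℝ) (D u) (D v) = (g x : E →L[ℝ] E →L[ℝ] ℝ) u v := by
    rintro z rfl D rfl u v
    rfl
  ext u v
  exact key _ (extChartAt_to_inv x) _ h u v

omit [I.Boundaryless] in
/-- Congruence for a field of bilinear forms at equal points, for vectors in the model space, with
which all tangent spaces agree definitionally. -/
theorem BilinField.congr (g : BilinField I M) {x x' : M} (hx : x = x') {a a' b b' : E}
    (ha : a = a') (hb : b = b') :
    (g x : E →L[ℝ] E →L[ℝ] ℝ) a b = (g x' : E →L[ℝ] E →L[ℝ] ℝ) a' b' := by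
  subst hx ha hb
  rfl

omit [I.Boundaryless] in
theorem inChart_symm [IsManifold I ∞ M] (g : SmoothMetric I M) (x₀ : M) (y u v : E) :
    inChart g.inner x₀ y u v = inChart g.inner x₀ y v u :=
  (inChart_apply _ _ _ _ _).trans ((g.symm _ _ _).trans (inChart_apply _ _ _ _ _).symm)

theorem contDiffAt_inChart [IsManifold I ∞ M] (g : SmoothMetric I M) (x₀ : M) :
    ContDiffAt ℝ ∞ (inChart g.inner x₀) (extChartAt I x₀ x₀) := by
  have : IsManifold I 1 M := IsManifold.of_le (n := ∞) (by simp)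
  have htar := extChartAt_target_mem_nhds (I := I) x₀
  have h₁ := ((contMDiffAt_hom_bundle _).1 (g.contMDiff x₀)).2
  have h₂ : ContMDiffAt 𝓘(ℝ, E) I ∞ (extChartAt I x₀).symm (extChartAt I x₀ x₀) :=
    (contMDiffOn_extChartAt_symm x₀).contMDiffAt htar
  have h₃ := ContMDiffAt.comp_of_eq h₁ h₂ (extChartAt_to_inv x₀)
  refine (contMDiffAt_iff_contDiffAt.1 h₃).congr_of_eventuallyEq ?_
  filter_upwards [htar] with y hy
  have hx : (extChartAt I x₀).symm y ∈
      (trivializationAt E (TangentSpace I : M → Type _) x₀).baseSet := by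
    simpa using (extChartAt I x₀).map_target hy
  have hs : ∀ w : E, (mfderiv 𝓘(ℝ, E) I (extChartAt I x₀).symm y w : E) =
      (trivializationAt E (TangentSpace I : M → Type _) x₀).symm
        ((extChartAt I x₀).symm y) w := fun w =>
    (congrArg (fun L : E →L[ℝ] E => L w) (mfderiv_extChartAt_symm_eq_symmL hy)).trans
      (Trivialization.symmL_apply _ hx w)
  ext u v
  refine Eq.trans ?_ (inCoordinates_apply_eq₂ hx hx (mem_univ _)).symm
  simp only [Trivial.fiberBundle_trivializationAt', Trivial.linearMapAt_trivialization,
    LinearMap.id_apply]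
  exact (inChart_apply _ _ _ _ _).trans (BilinField.congr g.inner rfl (hs u) (hs v))

theorem inChart_pos [IsManifold I ∞ M] (g : SmoothMetric I M) {x₀ : M} {y : E}
    (hy : y ∈ (extChartAt I x₀).target) {u : E} (hu : u ≠ 0) :
    0 < inChart g.inner x₀ y u u := by
  have : IsManifold I 1 M := IsManifold.of_le (n := ∞) (by simp)
  have h := isInvertible_mfderivWithin_extChartAt_symm (I := I) hy
  rw [I.range_eq_univ, mfderivWithin_univ] at h
  refine g.pos _ _ fun h0 => hu (h.injective ?_)
  exact h0.trans (map_zero _).symm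

theorem isMetricGerm_inChart [FiniteDimensional ℝ E] [IsManifold I ∞ M] (g : SmoothMetric I M)
    (x₀ : M) : IsMetricGerm (inChart g.inner x₀) (extChartAt I x₀ x₀) where
  contDiffAt := (contDiffAt_inChart g x₀).of_le (WithTop.coe_le_coe.2 le_top)
  symm := .of_forall fun z u v => inChart_symm g x₀ z u v
  isInvertible := by
    filter_upwards [extChartAt_target_mem_nhds (I := I) x₀] with y hy
    exact isInvertible_of_pos fun u hu => inChart_pos g hy hu

variable {E' : Type*} [NormedAddCommGroup E'] [NormedSpace ℝ E']
  {H' : Type*} [TopologicalSpace H'] {I' : ModelWithCorners ℝ E' H'} [I'.Boundaryless]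
  {M' : Type*} [TopologicalSpace M'] [ChartedSpace H' M']

/-- The derivative of an inverse product chart respects the two factors; this is obtained from the
chain rule for the composition with the projection. -/
theorem mfderiv_extChartAt_prod_symm_fst [IsManifold I 1 M] [IsManifold I' 1 M']
    {p : M × M'} {z : E × E'} (hz : z ∈ (extChartAt (I.prod I') p).target) (w : E × E') :
    (mfderiv 𝓘(ℝ, E × E') (I.prod I') (extChartAt (I.prod I') p).symm z w : E × E').1 =
      mfderiv 𝓘(ℝ, E) I (extChartAt I p.1).symm z.1 w.1 := by
  have hz' := hz
  rw [extChartAt_prod, PartialEquiv.prod_target] at hz'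
  have h₁ := mfderiv_comp z (mdifferentiableAt_fst (I := I) (I' := I'))
    (mdifferentiableAt_extChartAt_symm hz)
  have h₂ := mfderiv_comp z (mdifferentiableAt_extChartAt_symm hz'.1)
    (differentiableAt_fst (𝕜 := ℝ) (E := E) (F := E') (p := z)).mdifferentiableAt
  have h₃ : Prod.fst ∘ (extChartAt (I.prod I') p).symm =
      (extChartAt I p.1).symm ∘ (Prod.fst : E × E' → E) := by
    rw [extChartAt_prod]; rfl
  rw [mfderiv_fst, h₃] at h₁
  rw [mfderiv_eq_fderiv, fderiv_fst] at h₂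
  exact congrArg (fun L : E × E' →L[ℝ] E => L w) (h₁.symm.trans h₂)

theorem mfderiv_extChartAt_prod_symm_snd [IsManifold I 1 M] [IsManifold I' 1 M']
    {p : M × M'} {z : E × E'} (hz : z ∈ (extChartAt (I.prod I') p).target) (w : E × E') :
    (mfderiv 𝓘(ℝ, E × E') (I.prod I') (extChartAt (I.prod I') p).symm z w : E × E').2 =
      mfderiv 𝓘(ℝ, E') I' (extChartAt I' p.2).symm z.2 w.2 := by
  have hz' := hz
  rw [extChartAt_prod, PartialEquiv.prod_target] at hz'
  have h₁ := mfderiv_comp z (mdifferentiableAt_snd (I := I) (I' := I'))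
    (mdifferentiableAt_extChartAt_symm hz)
  have h₂ := mfderiv_comp z (mdifferentiableAt_extChartAt_symm hz'.2)
    (differentiableAt_snd (𝕜 := ℝ) (E := E) (F := E') (p := z)).mdifferentiableAt
  have h₃ : Prod.snd ∘ (extChartAt (I.prod I') p).symm =
      (extChartAt I' p.2).symm ∘ (Prod.snd : E × E' → E') := by
    rw [extChartAt_prod]; rfl
  rw [mfderiv_snd, h₃] at h₁
  rw [mfderiv_eq_fderiv, fderiv_snd] at h₂
  exact congrArg (fun L : E × E' →L[ℝ] E' => L w) (h₁.symm.trans h₂)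

theorem isProductNear_inChart [IsManifold I ∞ M] [IsManifold I' ∞ M']
    (g₁ : SmoothMetric I M) (g₂ : SmoothMetric I' M') (p : M × M') :
    IsProductNear (inChart (productMetric g₁ g₂).inner p) (inChart g₁.inner p.1)
      (inChart g₂.inner p.2) (extChartAt (I.prod I') p p) := by
  have : IsManifold I 1 M := IsManifold.of_le (n := ∞) (by simp)
  have : IsManifold I' 1 M' := IsManifold.of_le (n := ∞) (by simp)
  filter_upwards [extChartAt_target_mem_nhds (I := I.prod I') p] with z hz u v
  have hpt : (extChartAt (I.prod I') p).symm z =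
      ((extChartAt I p.1).symm z.1, (extChartAt I' p.2).symm z.2) := by
    rw [extChartAt_prod]; rfl
  refine (inChart_apply _ _ _ _ _).trans ((productMetric_apply g₁ g₂ _ _ _).trans
    (congrArg₂ (· + ·) (Eq.trans ?_ (inChart_apply _ _ _ _ _).symm)
      (Eq.trans ?_ (inChart_apply _ _ _ _ _).symm)))
  · exact BilinField.congr g₁.inner (congrArg Prod.fst hpt)
      (mfderiv_extChartAt_prod_symm_fst hz u) (mfderiv_extChartAt_prod_symm_fst hz v)
  · exact BilinField.congr g₂.inner (congrArg Prod.snd hpt)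
      (mfderiv_extChartAt_prod_symm_snd hz u) (mfderiv_extChartAt_prod_symm_snd hz v)

theorem riemann_productMetric [FiniteDimensional ℝ E] [FiniteDimensional ℝ E']
    [IsManifold I ∞ M] [IsManifold I' ∞ M']
    (g₁ : SmoothMetric I M) (g₂ : SmoothMetric I' M') (p : M × M')
    (u v w : E × E') :
    (riemann (productMetric g₁ g₂).inner p u v w : E × E') =
      (riemann g₁.inner p.1 u.1 v.1 w.1, riemann g₂.inner p.2 u.2 v.2 w.2) := by
  have := FiniteDimensional.complete ℝ E
  have := FiniteDimensional.complete ℝ E'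
  exact (isProductNear_inChart g₁ g₂ p).curvature (isMetricGerm_inChart _ p)
    (isMetricGerm_inChart g₁ p.1) (isMetricGerm_inChart g₂ p.2) u v w

/-- If `g` is locally conformally flat, then at every point the `(0,4)` curvature tensor of `g`
has the values `A(u) + A(v)` on orthonormal pairs `u, v`, for some function `A`. -/
theorem IsLocallyConformallyFlat.exists_lowered_riemann [FiniteDimensional ℝ E]
    [IsManifold I ∞ M] {g : SmoothMetric I M} (hg : IsLocallyConformallyFlat g.inner) (x : M) :
    ∃ A : E → ℝ, ∀ u v : E, g.inner x u u = 1 → g.inner x v v = 1 → g.inner x u v = 0 →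
      lowered (V := E) (g.inner x) (riemann g.inner x) u v u v = A u + A v := by
  have := FiniteDimensional.complete ℝ E
  have : IsManifold I 1 M := IsManifold.of_le (n := ∞) (by simp)
  obtain ⟨U, hU, hxU, f, hf, hpos, hflat⟩ := hg x
  set y := extChartAt I x x with hy
  have hG := isMetricGerm_inChart g x
  have hF : ContDiffAt ℝ 2 (f ∘ (extChartAt I x).symm) y := by
    have h₂ : ContMDiffAt 𝓘(ℝ, E) I ∞ (extChartAt I x).symm y :=
      (contMDiffOn_extChartAt_symm x).contMDiffAt (extChartAt_target_mem_nhds x)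
    have h₁ : ContMDiffAt I 𝓘(ℝ, ℝ) ∞ f x := hf.contMDiffAt (hU.mem_nhds hxU)
    exact (contMDiffAt_iff_contDiffAt.1
      (ContMDiffAt.comp_of_eq h₁ h₂ (extChartAt_to_inv x))).of_le (WithTop.coe_le_coe.2 le_top)
  have hFy : (f ∘ (extChartAt I x).symm) y = f x := congrArg f (extChartAt_to_inv x)
  have h0 := (hpos x hxU).ne'
  obtain ⟨A, hA⟩ := hG.exists_lowered_curvature_smul hF (by rwa [hFy])
  rw [hFy, inChart_self] at hA
  refine ⟨A, fun u v hu hv huv => ?_⟩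
  have hli : LinearIndependent ℝ ![u, v] := by
    refine LinearIndependent.pair_iff.2 fun s t hst => ?_
    have k₁ : g.inner x u (s • u + t • v) = 0 := by rw [hst]; exact map_zero _
    have k₂ : g.inner x v (s • u + t • v) = 0 := by rw [hst]; exact map_zero _
    have huv' : g.inner x v u = 0 := (g.symm x v u).trans huv
    erw [map_add, map_smul, map_smul, hu, huv] at k₁
    erw [map_add, map_smul, map_smul, hv, huv'] at k₂
    simp at k₁ k₂
    exact ⟨k₁, k₂⟩
  have hK := hflat x hxU u v hli
  have hR : riemann (fun x => f x • g.inner x) x =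
      curvature (fun z => (f ∘ (extChartAt I x).symm) z • inChart g.inner x z) y := rfl
  replace hK := div_eq_zero_iff.1 hK
  have hden : (f x • g.inner x) u u * (f x • g.inner x) v v - (f x • g.inner x) u v ^ 2 ≠ 0 := by
    have e : ∀ a b : E, (f x • g.inner x) a b = f x * g.inner x a b := fun a b => rfl
    rw [e, e, e, hu, hv, huv]
    simpa using h0
  have hK' := hK.resolve_right hden
  rw [hR] at hK'
  have := (hA u v hu hv huv).symm.trans hK'
  have := (mul_eq_zero.1 this).resolve_left h0
  exact sub_eq_zero.1 ((sub_sub _ _ _).symm.trans this)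

end Charts

/-! ### Curvature tensors of hyperbolic surfaces and their products -/

section PointwiseAlgebra

variable {E : Type*} [NormedAddCommGroup E] [NormedSpace ℝ E]
  {E' : Type*} [NormedAddCommGroup E'] [NormedSpace ℝ E']

theorem curvature_antisymm (G : E → E →L[ℝ] E →L[ℝ] ℝ) (y u v w : E) :
    curvature G y u v w = -curvature G y v u w := by
  rw [curvature_apply, curvature_apply]
  abel

/-- In dimension two the sectional curvature determines the curvature tensor, without recourse to
its symmetry `b(R(u, v) w, w) = 0`: this symmetry follows by comparing the planes spanned by `u, v`
and by `u + v, v`. -/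
theorem eq_of_sectional_eq_neg_one (hE : Module.finrank ℝ E = 2) {b : E →L[ℝ] E →L[ℝ] ℝ}
    (hs : ∀ u v, b u v = b v u) (hpos : ∀ u, u ≠ 0 → 0 < b u u)
    {R : E →L[ℝ] E →L[ℝ] E →L[ℝ] E} (hR : ∀ u v w, R u v w = -R v u w)
    (hK : ∀ u v, LinearIndependent ℝ ![u, v] →
      lowered b R u v u v / (b u u * b v v - b u v ^ 2) = -1) (u v w : E) :
    R u v w = b u w • v - b v w • u := by
  have : FiniteDimensional ℝ E := Module.finite_of_finrank_eq_succ hE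
  let f : Module.Basis (Fin 2) ℝ E := Module.finBasisOfFinrankEq ℝ E hE
  have hli : LinearIndependent ℝ ![f 0, f 1] := by
    convert f.linearIndependent using 1
    ext i; fin_cases i <;> rfl
  have hval : ∀ u v, LinearIndependent ℝ ![u, v] →
      b (R u v v) u = -(b u u * b v v - b u v ^ 2) := fun u v huv => by
    have h := hK u v huv
    have hne : b u u * b v v - b u v ^ 2 ≠ 0 := fun h0 => by
      rw [h0, div_zero] at h; norm_num at h
    rw [div_eq_iff hne] at h
    simpa [lowered] using h
  have hext : ∀ x y : E, (∀ i, b x (f i) = b y (f i)) → x = y := fun x y h => by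
    by_contra hxy
    have h1 : (b x : E →ₗ[ℝ] ℝ) = b y := f.ext h
    have h2 : b x (x - y) = b y (x - y) := congrArg (fun L : E →ₗ[ℝ] ℝ => L (x - y)) h1
    have h3 := hpos (x - y) (sub_ne_zero.2 hxy)
    rw [map_sub b, sub_apply, h2, sub_self] at h3
    exact h3.false
  have hself : ∀ u w, R u u w = 0 := fun u w => by
    have h := hR u u w
    rwa [eq_neg_iff_add_eq_zero, ← two_smul ℝ, smul_eq_zero_iff_right two_ne_zero] at h
  -- the second component is what the plane spanned by `u + v, v` adds to that spanned by `u, v`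
  have hpair : ∀ u v, LinearIndependent ℝ ![u, v] →
      b (R u v v) u = b (b u v • v - b v v • u) u ∧
      b (R u v v) v = b (b u v • v - b v v • u) v := fun u v huv => by
    have huv' : LinearIndependent ℝ ![u + v, v] := LinearIndependent.pair_add_left_iff.2 huv
    have h1 := hval u v huv
    have h2 := hval _ _ huv'
    simp only [map_add, map_sub, map_smul, add_apply, sub_apply, smul_apply, smul_eq_mul, hself,
      add_zero, hs v u] at h1 h2 ⊢
    constructor <;> linarith
  have h01 : R (f 0) (f 1) (f 1) = b (f 0) (f 1) • f 1 - b (f 1) (f 1) • f 0 := by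
    have h := hpair _ _ hli
    exact hext _ _ (Fin.forall_fin_two.2 h)
  have h10 : R (f 1) (f 0) (f 0) = b (f 1) (f 0) • f 0 - b (f 0) (f 0) • f 1 := by
    have h := hpair _ _ (LinearIndependent.pair_symm_iff.1 hli)
    exact hext _ _ (Fin.forall_fin_two.2 h.symm)
  have hc : ∀ x, ∃ s t : ℝ, x = s • f 0 + t • f 1 := fun x =>
    ⟨f.repr x 0, f.repr x 1, by rw [← Fin.sum_univ_two (fun i => f.repr x i • f i), f.sum_repr]⟩
  obtain ⟨u₀, u₁, rfl⟩ := hc u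
  obtain ⟨v₀, v₁, rfl⟩ := hc v
  obtain ⟨w₀, w₁, rfl⟩ := hc w
  simp only [map_add, map_smul, add_apply, smul_apply, hself, hR (f 1) (f 0) (f 1),
    hR (f 0) (f 1) (f 0), h01, h10, hs (f 1) (f 0), smul_eq_mul]
  module

theorem exists_orthonormal_pair (hE : Module.finrank ℝ E = 2) {b : E →L[ℝ] E →L[ℝ] ℝ}
    (hpos : ∀ u, u ≠ 0 → 0 < b u u) : ∃ u v, b u u = 1 ∧ b v v = 1 ∧ b u v = 0 := by
  have : FiniteDimensional ℝ E := Module.finite_of_finrank_eq_succ hE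
  let f : Module.Basis (Fin 2) ℝ E := Module.finBasisOfFinrankEq ℝ E hE
  have hunit : ∀ u, u ≠ 0 → ∃ c : ℝ, b (c • u) (c • u) = 1 := fun u hu => by
    refine ⟨(√(b u u))⁻¹, ?_⟩
    have h := hpos u hu
    have h2 := Real.sq_sqrt h.le
    have h3 : √(b u u) ≠ 0 := (Real.sqrt_pos.2 h).ne'
    simp only [map_smul, smul_apply, smul_eq_mul]
    field_simp
    exact h2.symm
  obtain ⟨c, hc⟩ := hunit (f 0) (f.ne_zero 0)
  set u := c • f 0 with hu
  have hne : f 1 - b u (f 1) • u ≠ 0 := fun h0 => by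
    have h := congrArg (fun x => f.repr x 1) h0
    simp [hu] at h
  obtain ⟨d, hd⟩ := hunit _ hne
  refine ⟨u, _, hc, hd, ?_⟩
  simp only [map_smul, map_sub, smul_eq_mul, hc]
  ring

variable {b₁ : E →L[ℝ] E →L[ℝ] ℝ} {b₂ : E' →L[ℝ] E' →L[ℝ] ℝ}
  {b : E × E' →L[ℝ] E × E' →L[ℝ] ℝ} {R : E × E' →L[ℝ] E × E' →L[ℝ] E × E' →L[ℝ] E × E'}

/-- `R` is the curvature tensor, and `b` the metric, of a product of two hyperbolic manifolds. -/
structure IsHyperbolicSum (b₁ : E →L[ℝ] E →L[ℝ] ℝ) (b₂ : E' →L[ℝ] E' →L[ℝ] ℝ)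
    (b : E × E' →L[ℝ] E × E' →L[ℝ] ℝ)
    (R : E × E' →L[ℝ] E × E' →L[ℝ] E × E' →L[ℝ] E × E') : Prop where
  metric : ∀ u v, b u v = b₁ u.1 v.1 + b₂ u.2 v.2
  curv : ∀ u v w, R u v w =
    (b₁ u.1 w.1 • v.1 - b₁ v.1 w.1 • u.1, b₂ u.2 w.2 • v.2 - b₂ v.2 w.2 • u.2)
  symm : ∀ u v, b u v = b v u
  pos : ∀ u, u ≠ 0 → 0 < b u u

/-- A product of hyperbolic surfaces is Einstein, with `Ric = -b`. -/
theorem IsHyperbolicSum.ricci_eq (h : IsHyperbolicSum b₁ b₂ b R)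
    (hE : Module.finrank ℝ E = 2) (hE' : Module.finrank ℝ E' = 2) (u v : E × E') :
    ricci R u v = -b u v := by
  have : FiniteDimensional ℝ E := Module.finite_of_finrank_eq_succ hE
  have : FiniteDimensional ℝ E' := Module.finite_of_finrank_eq_succ hE'
  have key : (((R.flip u).flip v : E × E' →L[ℝ] E × E') : E × E' →ₗ[ℝ] E × E') =
      LinearMap.prodMap
        ((b₁.flip v.1 : E →ₗ[ℝ] ℝ).smulRight u.1 - b₁ u.1 v.1 • LinearMap.id)
        ((b₂.flip v.2 : E' →ₗ[ℝ] ℝ).smulRight u.2 - b₂ u.2 v.2 • LinearMap.id) := by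
    refine LinearMap.ext fun w => ?_
    exact h.curv w u v
  change LinearMap.trace ℝ (E × E') _ = _
  rw [key, LinearMap.trace_prodMap', map_sub, map_sub, map_smul, map_smul,
    LinearMap.trace_smulRight, LinearMap.trace_smulRight, LinearMap.trace_id, LinearMap.trace_id,
    hE, hE', h.metric]
  simp
  ring

theorem IsHyperbolicSum.scalar_eq [FiniteDimensional ℝ E] [FiniteDimensional ℝ E']
    (h : IsHyperbolicSum b₁ b₂ b R)
    (hE : Module.finrank ℝ E = 2) (hE' : Module.finrank ℝ E' = 2) : scalar b R = -4 := by
  have hb := isInvertible_of_pos h.pos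
  have key : ((b.inverse : (E × E' →L[ℝ] ℝ) →ₗ[ℝ] E × E') ∘ₗ
      (LinearMap.toContinuousLinearMap :
        (E × E' →ₗ[ℝ] ℝ) ≃ₗ[ℝ] (E × E' →L[ℝ] ℝ)).toLinearMap ∘ₗ ricci R) = -LinearMap.id := by
    refine LinearMap.ext fun u => ?_
    have h1 : LinearMap.toContinuousLinearMap (ricci R u) = b (-u) := by
      ext v
      all_goals simp [h.ricci_eq hE hE']
    change b.inverse (LinearMap.toContinuousLinearMap (ricci R u)) = -u
    rw [h1, hb.inverse_apply_self]
  rw [scalar, key, map_neg, LinearMap.trace_id, Module.finrank_prod, hE, hE']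
  norm_num

theorem IsHyperbolicSum.weyl_eq [FiniteDimensional ℝ E] [FiniteDimensional ℝ E']
    (h : IsHyperbolicSum b₁ b₂ b R)
    (hE : Module.finrank ℝ E = 2) (hE' : Module.finrank ℝ E' = 2) (u v w z : E × E') :
    weyl b R u v w z = lowered b R u v w z + (b u w * b v z - b v w * b u z) / 3 := by
  have ht : ∀ p q, tracefreeRicci b R p q = 0 := fun p q => by
    rw [tracefreeRicci, h.scalar_eq hE hE', h.ricci_eq hE hE', Module.finrank_prod, hE, hE']
    norm_num
  simp only [weyl, kulkarniNomizu, ht, h.scalar_eq hE hE', Module.finrank_prod, hE, hE']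
  push_cast
  ring

end PointwiseAlgebra

/-! ### Orthonormal bases and anti-self-dual two-forms -/

section AntiSelfDual

variable {V : Type*} [NormedAddCommGroup V] [NormedSpace ℝ V] {b : V →L[ℝ] V →L[ℝ] ℝ}

theorem linearIndependent_of_orthonormal {ι : Type*} [DecidableEq ι] {e : ι → V}
    (he : ∀ i j, b (e i) (e j) = if i = j then 1 else 0) : LinearIndependent ℝ e := by
  refine linearIndependent_iff'.2 fun s c hc i hi => ?_
  have h : b (∑ j ∈ s, c j • e j) (e i) = 0 := by rw [hc]; simp
  simpa [map_sum, _root_.sum_apply, he, hi] using h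

/-- The transition matrix between orthonormal bases with the same orientation is in `SO(n)`. -/
theorem toMatrix_orthonormal {ι : Type*} [Fintype ι] [DecidableEq ι]
    {e f : Module.Basis ι ℝ V}
    (he : ∀ i j, b (e i) (e j) = if i = j then 1 else 0)
    (hf : ∀ i j, b (f i) (f j) = if i = j then 1 else 0) (ho : e.orientation = f.orientation) :
    (e.toMatrix f).transpose * e.toMatrix f = 1 ∧ (e.toMatrix f).det = 1 := by
  have h1 : (e.toMatrix f).transpose * e.toMatrix f = 1 := by
    ext i j
    have h := hf i j
    rw [← e.sum_repr (f i), ← e.sum_repr (f j)] at h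
    simp only [map_sum, map_smul, _root_.sum_apply, smul_apply, smul_eq_mul, he,
      mul_ite, mul_one, mul_zero, Finset.sum_ite_eq', Finset.mem_univ, if_true] at h
    rw [Matrix.mul_apply, Matrix.one_apply, ← h]
    refine Finset.sum_congr rfl fun k _ => ?_
    simp only [Matrix.transpose_apply, Module.Basis.toMatrix_apply]
    ring
  refine ⟨h1, ?_⟩
  have h2 := congrArg Matrix.det h1
  rw [Matrix.det_mul, Matrix.det_transpose, Matrix.det_one] at h2
  have h3 := (e.orientation_eq_iff_det_pos f).1 ho
  rw [Module.Basis.det_apply] at h3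
  nlinarith

/-- The Hodge star of the two-form on `ℝ⁴` with the skew-symmetric matrix `P`. Only the entries of
`P` above the diagonal are used. -/
def starMatrix (P : Matrix (Fin 4) (Fin 4) ℝ) : Matrix (Fin 4) (Fin 4) ℝ :=
  !![0, P 2 3, -P 1 3, P 1 2;
     -P 2 3, 0, P 0 3, -P 0 2;
     P 1 3, -P 0 3, 0, P 0 1;
     -P 1 2, P 0 2, -P 0 1, 0]

/-- The matrix of the two-form `e⁰ ∧ e¹ - e² ∧ e³`. -/
def antiMatrix : Matrix (Fin 4) (Fin 4) ℝ :=
  !![0, 1, 0, 0; -1, 0, 0, 0; 0, 0, 0, -1; 0, 0, 1, 0]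

set_option maxHeartbeats 1000000 in
/-- The Hodge star is equivariant up to the determinant: `B * star(Bᵀ N B) * Bᵀ = det B • star N`,
a polynomial identity in the entries of `B`, for the anti-self-dual matrix `N = antiMatrix`. -/
theorem transpose_mul_starMatrix_mul (B : Matrix (Fin 4) (Fin 4) ℝ) :
    B * starMatrix (B.transpose * antiMatrix * B) * B.transpose = -B.det • antiMatrix := by
  have hdet : B.det = _ := Matrix.det_succ_row_zero B
  simp [Matrix.det_fin_three, Fin.sum_univ_four, Matrix.submatrix, Fin.succAbove] at hdet
  rw [hdet]
  ext i j
  fin_cases i <;> fin_cases j <;>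
    simp [Matrix.mul_apply, Fin.sum_univ_four, starMatrix, antiMatrix] <;> ring

/-- The matrix `antiMatrix` stays anti-self-dual in every oriented orthonormal basis. -/
theorem starMatrix_of_orthogonal {B : Matrix (Fin 4) (Fin 4) ℝ} (hB : B.transpose * B = 1)
    (hdet : B.det = 1) :
    starMatrix (B.transpose * antiMatrix * B) = -(B.transpose * antiMatrix * B) := by
  have h := transpose_mul_starMatrix_mul B
  rw [hdet, neg_smul, one_smul] at h
  set P := starMatrix (B.transpose * antiMatrix * B)
  calc P = (B.transpose * B) * P * (B.transpose * B) := by rw [hB, one_mul, mul_one]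
    _ = B.transpose * (B * P * B.transpose) * B := by simp only [mul_assoc]
    _ = _ := by rw [h, mul_neg, neg_mul]

/-- The two-form `e⁰ ∧ e¹ - e² ∧ e³`. -/
def antiForm (e : Module.Basis (Fin 4) ℝ V) : V [⋀^Fin 2]→ₗ[ℝ] ℝ :=
  Matrix.detRowAlternating.compLinearMap (LinearMap.pi ![e.coord 0, e.coord 1]) -
    Matrix.detRowAlternating.compLinearMap (LinearMap.pi ![e.coord 2, e.coord 3])

theorem antiForm_apply (e : Module.Basis (Fin 4) ℝ V) (u v : V) :
    antiForm e ![u, v] = (e.repr u 0 * e.repr v 1 - e.repr u 1 * e.repr v 0) -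
      (e.repr u 2 * e.repr v 3 - e.repr u 3 * e.repr v 2) := by
  have h : ∀ a c : V →ₗ[ℝ] ℝ, Matrix.detRowAlternating.compLinearMap (LinearMap.pi ![a, c])
      ![u, v] = a u * c v - c u * a v := fun a c => by
    have hm : (fun i => LinearMap.pi ![a, c] (![u, v] i)) = !![a u, c u; a v, c v] := by
      ext i j
      fin_cases i <;> fin_cases j <;> rfl
    exact (congrArg Matrix.det hm).trans (Matrix.det_fin_two_of _ _ _ _)
  rw [antiForm, AlternatingMap.sub_apply, h, h]
  rfl

theorem antiForm_eq_matrix (e f : Module.Basis (Fin 4) ℝ V) (i j : Fin 4) :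
    antiForm e ![f i, f j] = ((e.toMatrix f).transpose * antiMatrix * e.toMatrix f) i j := by
  rw [antiForm_apply]
  simp [Matrix.mul_apply, Fin.sum_univ_four, antiMatrix, Module.Basis.toMatrix_apply]
  ring

theorem Ioi_fin_four : Finset.Ioi (0 : Fin 4) = {1, 2, 3} ∧ Finset.Ioi (1 : Fin 4) = {2, 3} ∧
    Finset.Ioi (2 : Fin 4) = {3} ∧ Finset.Ioi (3 : Fin 4) = ∅ := by decide

theorem antiForm_mem_antiSelfDualForms {o : Orientation ℝ V (Fin 4)}
    {e : Module.Basis (Fin 4) ℝ V} (he : IsOrientedOrthonormal b o e) :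
    antiForm e ∈ antiSelfDualForms b o := by
  intro f hf γ
  obtain ⟨hB, hdet⟩ := toMatrix_orthonormal he.1 hf.1 (he.2.trans hf.2.symm)
  have h := fun i j => congrFun (congrFun (starMatrix_of_orthogonal hB hdet) i) j
  simp only [Matrix.neg_apply, ← antiForm_eq_matrix e f] at h
  have h01 := h 0 1
  have h02 := h 0 2
  have h03 := h 0 3
  simp only [starMatrix, ← antiForm_eq_matrix e f] at h01 h02 h03
  simp at h01 h02 h03
  obtain ⟨i0, i1, i2, i3⟩ := Ioi_fin_four
  simp only [formInner, wedgeApply, Fin.sum_univ_four, i0, i1, i2, i3, AlternatingMap.neg_apply]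
  simp
  rw [h01, h02, h03]
  ring

end AntiSelfDual

/-! ### The product of two hyperbolic surfaces -/

section Product

variable {E : Type*} [NormedAddCommGroup E] [NormedSpace ℝ E]
  {E' : Type*} [NormedAddCommGroup E'] [NormedSpace ℝ E']
  {b₁ : E →L[ℝ] E →L[ℝ] ℝ} {b₂ : E' →L[ℝ] E' →L[ℝ] ℝ}
  {b : E × E' →L[ℝ] E × E' →L[ℝ] ℝ} {R : E × E' →L[ℝ] E × E' →L[ℝ] E × E' →L[ℝ] E × E'}

/-- Orthonormal bases of `E × E'` of which the first two vectors are tangent to the first factor and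
the last two are tangent to the second factor. -/
structure IsAdapted (b : E × E' →L[ℝ] E × E' →L[ℝ] ℝ)
    (e : Module.Basis (Fin 4) ℝ (E × E')) : Prop where
  orthonormal : ∀ i j, b (e i) (e j) = if i = j then 1 else 0
  snd_zero : (e 0).2 = 0
  snd_one : (e 1).2 = 0
  fst_two : (e 2).1 = 0
  fst_three : (e 3).1 = 0

theorem IsHyperbolicSum.exists_isAdapted (h : IsHyperbolicSum b₁ b₂ b R)
    (hE : Module.finrank ℝ E = 2) (hE' : Module.finrank ℝ E' = 2) :
    ∃ e : Module.Basis (Fin 4) ℝ (E × E'), IsAdapted b e := by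
  have : FiniteDimensional ℝ E := Module.finite_of_finrank_eq_succ hE
  have : FiniteDimensional ℝ E' := Module.finite_of_finrank_eq_succ hE'
  obtain ⟨u, v, hu, hv, huv⟩ := exists_orthonormal_pair (b := b₁) hE fun u hu => by
    have h1 := h.pos (u, 0) (by simpa using hu)
    simpa [h.metric] using h1
  obtain ⟨w, z, hw, hz, hwz⟩ := exists_orthonormal_pair (b := b₂) hE' fun u hu => by
    have h1 := h.pos (0, u) (by simpa using hu)
    simpa [h.metric] using h1
  have hvu : b₁ v u = 0 := by
    have h1 := h.symm (v, 0) (u, 0)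
    simpa [h.metric, huv] using h1
  have hzw : b₂ z w = 0 := by
    have h1 := h.symm (0, z) (0, w)
    simpa [h.metric, hwz] using h1
  let e : Fin 4 → E × E' := ![(u, 0), (v, 0), (0, w), (0, z)]
  have he : ∀ i j, b (e i) (e j) = if i = j then 1 else 0 := fun i j => by
    fin_cases i <;> fin_cases j <;> simp [e, h.metric, *]
  have hcard : Fintype.card (Fin 4) = Module.finrank ℝ (E × E') := by
    rw [Module.finrank_prod, hE, hE']; rfl
  have hcoe := coe_basisOfLinearIndependentOfCardEqFinrank
    (linearIndependent_of_orthonormal he) hcard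
  refine ⟨basisOfLinearIndependentOfCardEqFinrank
    (linearIndependent_of_orthonormal he) hcard, ?_, ?_, ?_, ?_, ?_⟩ <;> rw [hcoe]
  · exact he
  all_goals rfl

/-- Adaptedness does not depend on the signs of the basis vectors. -/
theorem IsAdapted.adjustToOrientation {e : Module.Basis (Fin 4) ℝ (E × E')} (he : IsAdapted b e)
    (o : Orientation ℝ (E × E') (Fin 4)) : IsAdapted b (e.adjustToOrientation o) := by
  have h := e.adjustToOrientation_apply_eq_or_eq_neg o
  refine ⟨fun i j => ?_, ?_, ?_, ?_, ?_⟩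
  · have hij := he.orthonormal i j
    by_cases hc : i = j
    · subst hc
      rcases h i with hi | hi <;> rw [hi] <;> simpa using hij
    · rw [if_neg hc] at hij ⊢
      rcases h i with hi | hi <;> rcases h j with hj | hj <;> rw [hi, hj] <;> simp [hij]
  · rcases h 0 with hi | hi <;> simp [hi, he.snd_zero]
  · rcases h 1 with hi | hi <;> simp [hi, he.snd_one]
  · rcases h 2 with hi | hi <;> simp [hi, he.fst_two]
  · rcases h 3 with hi | hi <;> simp [hi, he.fst_three]

/-- The curvature operator in an adapted basis: the tangent planes of the factors have sectional
curvature `-1`, mixed planes are flat. -/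
theorem IsHyperbolicSum.lowered_adapted (h : IsHyperbolicSum b₁ b₂ b R)
    {e : Module.Basis (Fin 4) ℝ (E × E')} (he : IsAdapted b e) :
    lowered b R (e 0) (e 1) (e 0) (e 1) = -1 ∧ lowered b R (e 2) (e 3) (e 2) (e 3) = -1 ∧
      lowered b R (e 0) (e 1) (e 2) (e 3) = 0 ∧ lowered b R (e 2) (e 3) (e 0) (e 1) = 0 ∧
      lowered b R (e 0) (e 2) (e 0) (e 2) = 0 ∧ lowered b R (e 1) (e 3) (e 1) (e 3) = 0 := by
  have ho := he.orthonormal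
  have h00 := ho 0 0
  have h11 := ho 1 1
  have h01 := ho 0 1
  have h10 := ho 1 0
  have h22 := ho 2 2
  have h33 := ho 3 3
  have h23 := ho 2 3
  have h32 := ho 3 2
  simp [h.metric, he.snd_zero, he.snd_one, he.fst_two, he.fst_three]
    at h00 h11 h01 h10 h22 h33 h23 h32
  simp [lowered, h.metric, h.curv, he.snd_zero, he.snd_one, he.fst_two, he.fst_three, *]

/-- `⟨W α, α⟩ = -4 / 3` for the anti-self-dual form `α = e⁰ ∧ e¹ - e² ∧ e³` of an adapted basis. -/
theorem IsHyperbolicSum.operatorInner_weyl [FiniteDimensional ℝ E] [FiniteDimensional ℝ E']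
    (h : IsHyperbolicSum b₁ b₂ b R)
    (hE : Module.finrank ℝ E = 2) (hE' : Module.finrank ℝ E' = 2)
    {e : Module.Basis (Fin 4) ℝ (E × E')} (he : IsAdapted b e) :
    operatorInner e (weyl b R) (antiForm e) (antiForm e) = -4 / 3 := by
  obtain ⟨l1, l2, l3, l4, -, -⟩ := h.lowered_adapted he
  obtain ⟨i0, i1, i2, i3⟩ := Ioi_fin_four
  have ha : ∀ i j, antiForm e ![e i, e j] = antiMatrix i j := fun i j => by
    rw [antiForm_eq_matrix, Module.Basis.toMatrix_self, Matrix.transpose_one, one_mul, mul_one]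
  simp only [operatorInner, Fin.sum_univ_four, i0, i1, i2, i3, ha]
  simp [antiMatrix, h.weyl_eq hE hE', l1, l2, l3, l4, he.orthonormal]
  norm_num

variable {H : Type*} [TopologicalSpace H] {I : ModelWithCorners ℝ E H} [I.Boundaryless]
  {M : Type*} [TopologicalSpace M] [ChartedSpace H M] [IsManifold I ∞ M]
  {H' : Type*} [TopologicalSpace H'] {I' : ModelWithCorners ℝ E' H'} [I'.Boundaryless]
  {M' : Type*} [TopologicalSpace M'] [ChartedSpace H' M'] [IsManifold I' ∞ M']

omit [I.Boundaryless] in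
/-- The curvature tensor of a hyperbolic surface. -/
theorem IsHyperbolic.riemann_eq (hE : Module.finrank ℝ E = 2) {g : SmoothMetric I M}
    (hg : IsHyperbolic g.inner) (x : M) (u v w : E) :
    (riemann g.inner x u v w : E) = (g.inner x u w : ℝ) • v - (g.inner x v w : ℝ) • u :=
  eq_of_sectional_eq_neg_one (b := g.inner x) (R := riemann g.inner x) hE (g.symm x)
    (g.pos x) (curvature_antisymm _ _) (hg x (mem_univ x)) u v w

theorem isHyperbolicSum_productMetric (hE : Module.finrank ℝ E = 2)
    (hE' : Module.finrank ℝ E' = 2) {g₁ : SmoothMetric I M} {g₂ : SmoothMetric I' M'}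
    (h₁ : IsHyperbolic g₁.inner) (h₂ : IsHyperbolic g₂.inner) (p : M × M') :
    IsHyperbolicSum (E := E) (E' := E') (g₁.inner p.1) (g₂.inner p.2)
      ((productMetric g₁ g₂).inner p) (riemann (productMetric g₁ g₂).inner p) where
  metric := productMetric_apply g₁ g₂ p
  curv u v w := by
    have : FiniteDimensional ℝ E := Module.finite_of_finrank_eq_succ hE
    have : FiniteDimensional ℝ E' := Module.finite_of_finrank_eq_succ hE'
    exact (riemann_productMetric g₁ g₂ p u v w).trans
      (Prod.ext (h₁.riemann_eq hE p.1 u.1 v.1 w.1) (h₂.riemann_eq hE' p.2 u.2 v.2 w.2))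
  symm := (productMetric g₁ g₂).symm p
  pos := (productMetric g₁ g₂).pos p

theorem not_isLocallyConformallyFlat_productMetric [Nonempty M] [Nonempty M']
    (hE : Module.finrank ℝ E = 2)
    (hE' : Module.finrank ℝ E' = 2) {g₁ : SmoothMetric I M} {g₂ : SmoothMetric I' M'}
    (h₁ : IsHyperbolic g₁.inner) (h₂ : IsHyperbolic g₂.inner) :
    ¬ IsLocallyConformallyFlat (productMetric g₁ g₂).inner := fun hflat => by
  have : FiniteDimensional ℝ E := Module.finite_of_finrank_eq_succ hE
  have : FiniteDimensional ℝ E' := Module.finite_of_finrank_eq_succ hE'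
  obtain ⟨p⟩ : Nonempty (M × M') := inferInstance
  have h := isHyperbolicSum_productMetric hE hE' h₁ h₂ p
  obtain ⟨e, he⟩ := h.exists_isAdapted hE hE'
  obtain ⟨l1, l2, -, -, l5, l6⟩ := h.lowered_adapted he
  obtain ⟨A, hA⟩ := hflat.exists_lowered_riemann p
  have key : ∀ i j, i ≠ j → lowered (V := E × E') ((productMetric g₁ g₂).inner p)
      (riemann (productMetric g₁ g₂).inner p) (e i) (e j) (e i) (e j) = A (e i) + A (e j) :=
    fun i j hij => hA (e i) (e j) ((he.orthonormal i i).trans (if_pos rfl))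
      ((he.orthonormal j j).trans (if_pos rfl)) ((he.orthonormal i j).trans (if_neg hij))
  -- both sides sum to `A(e₀) + A(e₁) + A(e₂) + A(e₃)`
  have k1 := l1.symm.trans (key 0 1 (by decide))
  have k2 := l2.symm.trans (key 2 3 (by decide))
  have k3 := l5.symm.trans (key 0 2 (by decide))
  have k4 := l6.symm.trans (key 1 3 (by decide))
  linarith

theorem not_isSelfDual_productMetric [FiniteDimensional ℝ E] [FiniteDimensional ℝ E']
    [Nonempty M] [Nonempty M'] (hE : Module.finrank ℝ E = 2)
    (hE' : Module.finrank ℝ E' = 2) {g₁ : SmoothMetric I M} {g₂ : SmoothMetric I' M'}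
    (h₁ : IsHyperbolic g₁.inner) (h₂ : IsHyperbolic g₂.inner)
    [IsManifold (I.prod I') 1 (M × M')]
    (o : ManifoldOrientation (I.prod I') (M × M') 4) :
    ¬ IsSelfDual (productMetric g₁ g₂).inner o := fun hsd => by
  obtain ⟨p⟩ : Nonempty (M × M') := inferInstance
  have h := isHyperbolicSum_productMetric hE hE' h₁ h₂ p
  obtain ⟨e', he'⟩ := h.exists_isAdapted hE hE'
  have he := he'.adjustToOrientation (o.orient p)
  set e := e'.adjustToOrientation (o.orient p : Orientation ℝ (E × E') (Fin 4)) with hedef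
  have hor : IsOrientedOrthonormal (V := E × E') ((productMetric g₁ g₂).inner p) (o.orient p) e :=
    ⟨he.orthonormal, e'.orientation_adjustToOrientation _⟩
  have hα := antiForm_mem_antiSelfDualForms hor
  have h0 := (h.operatorInner_weyl hE hE' he).symm.trans (hsd p e hor _ hα _ hα)
  norm_num at h0

end Product

end HyperbolicProduct

end

theorem mainTheorem8
    {S : Type*} [TopologicalSpace S] [ChartedSpace (EuclideanSpace ℝ (Fin 2)) S]
    [IsManifold (𝓡 2) ∞ S]
    {T : Type*} [TopologicalSpace T] [ChartedSpace (EuclideanSpace ℝ (Fin 2)) T]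
    [IsManifold (𝓡 2) ∞ T]
    (g h : ℕ) (hg : 2 ≤ g) (hh : 2 ≤ h)
    (hS : HyperbolicProduct.IsClosedSurfaceOfGenus g S)
    (hT : HyperbolicProduct.IsClosedSurfaceOfGenus h T)
    (γS : HyperbolicProduct.SmoothMetric (𝓡 2) S) (γT : HyperbolicProduct.SmoothMetric (𝓡 2) T)
    (hγS : HyperbolicProduct.IsHyperbolic γS.inner)
    (hγT : HyperbolicProduct.IsHyperbolic γT.inner) :
    ¬ HyperbolicProduct.IsLocallyConformallyFlat
        (HyperbolicProduct.productMetric γS γT).inner ∧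
      ∀ o : HyperbolicProduct.ManifoldOrientation ((𝓡 2).prod (𝓡 2)) (S × T) 4,
        ¬ HyperbolicProduct.IsSelfDual (HyperbolicProduct.productMetric γS γT).inner o := by
  have := hS.connected
  have := hT.connected
  have h2 : Module.finrank ℝ (EuclideanSpace ℝ (Fin 2)) = 2 := finrank_euclideanSpace_fin
  exact ⟨HyperbolicProduct.not_isLocallyConformallyFlat_productMetric h2 h2 hγS hγT,
    HyperbolicProduct.not_isSelfDual_productMetric h2 h2 hγS hγT⟩
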